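/- Let $\mathsf V=(\mathsf V,\bigvee,\otimes,k)$ be a commutative unital quantale with internal hom $\hom$, and let $\mathcal T=(\mathbb T,\mathsf V,\xi)$ be a strict topological theory: $\mathbb T=(T,m,e)$ is a monad on $\mathsf{Set}$ such that $T$ sends pullbacks to weak pullbacks and every naturality square of $m$ is a weak pullback; $\xi:T\mathsf V\to\mathsf V$ is a $\mathbb T$-algebra for which $\otimes:\mathsf V\times\mathsf V\to\mathsf V$ and $k:1\to\mathsf V$ are homomorphisms; and the maps $\mathsf V^X\to\mathsf V^{TX}$, $\varphi\mapsto\xi\cdot T\varphi$, are order-preserving and natural with respect to direct images. Assume $T1=1$. A $\mathcal T$-matrix $\alpha:X\rightharpoonup Y$ is a map $\alpha:TY\times X\to\mathsf V$. The composite of $\alpha$ with $\beta:Y\rightharpoonup Z$ is $(\beta\circ\alpha)(\mathfrak z,x)=\bigvee_{m_Z(\mathfrak W)=\mathfrak z,\ \mathfrak y\in TY}T_\xi\beta(\mathfrak W,\mathfrak y)\otimes\alpha(\mathfrak y,x)$, where $T_\xi r(\mathfrak y,\mathfrak x)=\bigvee\{\xi(Tr(\mathfrak w)) : T\pi_1(\mathfrak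 w)=\mathfrak y,\ T\pi_2(\mathfrak w)=\mathfrak x\}$. A $\mathcal T$-graph is a set $X$ with a $\mathcal T$-matrix $a:X\rightharpoonup X$ such that $k\le a(e_X(x),x)$ for all $x$; it is a $\mathcal T$-category if also $a\circ a\le a$. A $\mathcal T$-graph morphism (between $\mathcal T$-categories: $\mathcal T$-functor) $f:(X,a)\to(Y,b)$ is a map with $a(\mathfrak x,x)\le b(Tf(\mathfrak x),f(x))$. The underlying $\mathsf V$-graph of $(X,a)$ has homs $a(e_X(x),y)$. A $\mathbb T$-algebra $\alpha:TI\to I$ is a $\mathcal T$-category with structure $k$ if $\alpha(\mathfrak i)=i$ and $\bot$ otherwise; $\mathsf V$ has structure $\hom(\xi(\mathfrak v),v)$; and $E$ is the one-point $\mathcal T$-category with structure $k$. A $\mathcal T$-distributor $\varphi:(X,a)\to(Y,b)$ is a $\mathcal T$-matrix $X\rightharpoonup Y$ with $\varphi\circ a\le\varphi$ and $b\circ\varphi\le\varphi$; distributors are ordered pointwise, $a$ is the identity on $(X,a)$, and $\varphi\dashv\psi$ for $\varphi:Y\to X$, $\psi:X\to Y$ means $b\le\psi\circ\varphi$ and $\varphi\circ\psi\le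 a$, where $a$ and $b$ are the structures of $X$ and $Y$. A $\mathcal T$-functor $f:(Y,b)\to(X,a)$ induces $f_*\dashv f^*$ with $f_*(\mathfrak x,y)=a(\mathfrak x,f(y))$ and $f^*(\mathfrak y,x)=a(Tf(\mathfrak y),x)$; for $x\in X$ put $x_*=a(-,x):E\to X$. $X$ is Cauchy complete if every adjunction $\varphi\dashv\psi$ of $\mathcal T$-distributors $\varphi:Y\to X$, $\psi:X\to Y$, with $Y$ any $\mathcal T$-category, is of the form $f_*\dashv f^*$ for some $\mathcal T$-functor $f:Y\to X$. For a $\mathcal T$-category $X=(X,a)$, let $\Omega(X)$ be the set of $\mathcal T$-functors $X\to\mathsf V$ with the $\mathcal T$-graph structure $$(\mathfrak p,\varphi)\mapsto\bigwedge\bigl\{\hom\bigl(a(T\pi_1(\mathfrak q),x),\hom(\xi\cdot T\mathrm{ev}(\mathfrak q),\varphi(x))\bigr) : \mathfrak q\in T(X\times\Omega(X)),\ T\pi_2(\mathfrak q)=\mathfrak p,\ x\in X\bigr\}.$$ In a $\mathcal T$-graph $A$ whose underlying $\mathsf V$-graph is a $\mathsf V$-category, a $\mathcal T$-weighted diagram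 consists of a $\mathbb T$-algebra $I$, a $\mathsf V$-category structure on $I$, a $\mathsf V$-functor $h:I\to A$ and a contravariant weight $\psi:I\to\mathsf V$ such that $i\mapsto\psi(i)\otimes h(i)$ exists and is a $\mathcal T$-graph morphism $I\to A$; a $\mathcal T$-colimit is a colimit of such a diagram, and a presheaf on $A$ is $\mathcal T$-generated if it is $\bigvee_iA(-,h(i))\otimes\psi(i)$ for such a diagram. $A$ is a $\mathcal T$-frame if its underlying $\mathsf V$-category is complete and, for every covariant weight $\varphi$ on a $\mathsf V$-category $I$ and every $\mathsf V$-functor $h:I\to PA$ into the $\mathsf V$-category of presheaves on $A$ with all $h(i)$ and $\lim(\varphi,h)$ $\mathcal T$-generated, $\sup_A(\lim(\varphi,h))=\lim(\varphi,\sup_A\cdot h)$. A $\mathcal T$-frame homomorphism $f:A\to B$ is a $\mathsf V$-functor that preserves weighted limits and $\mathcal T$-weighted colimits and is $\mathcal T$-compatible: for every $\mathbb T$-algebra $I$ and every $\mathcal T$-graph morphism $h:I\to A$, $f\cdot h$ is a $\mathcal T$-graph morphism. Homomorphisms into $\mathsf V$ are ordered pointwise, and the points of $\Omega(X)$ are the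 $\mathcal T$-frame homomorphisms $\Omega(X)\to\mathsf V$. **Theorem.** For every $\mathcal T$-category $X$, the $\mathcal T$-graphs $\Omega(X)$ and $\mathsf V$ are $\mathcal T$-frames, each $x_*$ is a left adjoint $\mathcal T$-distributor, each evaluation $\mathrm{ev}_x:\Omega(X)\to\mathsf V$ is a $\mathcal T$-frame homomorphism, and there is an isomorphism of ordered sets from the left adjoint $\mathcal T$-distributors $\psi:E\to X$ (the objects of the Cauchy completion of $X$) to the points of $\Omega(X)$, which sends $x_*$ to $\eta_X(x)=\mathrm{ev}_x$ for every $x\in X$ and sends $\psi\dashv\varphi$ to $[\varphi,-]:\theta\mapsto\bigwedge_{x\in X}\hom(\varphi(x),\theta(x))$. Hence $X$ is Cauchy complete if and only if $\eta_X$, $x\mapsto\mathrm{ev}_x$, from $X$ to the points of $\Omega(X)$ is surjective. -/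

import Mathlib

open CategoryTheory

universe u

noncomputable section

/-! ### Commutative quantales, monads on sets, strict topological theories -/

/-- The internal hom of a commutative quantale: `w * u ≤ v ↔ w ≤ qhom u v`. -/
abbrev qhom {V : Type u} [CompleteLattice V] [CommMonoid V] [IsQuantale V] (v w : V) : V :=
  Quantale.leftMulResiduation v w

theorem le_qhom_iff {V : Type u} [CompleteLattice V] [CommMonoid V] [IsQuantale V] {u v w : V} :
    u ≤ qhom v w ↔ u * v ≤ w :=
  Quantale.leftMulResiduation_le_iff_mul_le

/-- The set `T X`. -/
abbrev tObj (T : Monad (Type u)) (X : Type u) : Type u := T.obj X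

/-- The function `T f : T X → T Y`. -/
def tMap (T : Monad (Type u)) {X Y : Type u} (f : X → Y) : tObj T X → tObj T Y :=
  T.map (↾f)

/-- The unit `e_X : X → T X`. -/
def tUnit (T : Monad (Type u)) {X : Type u} : X → tObj T X :=
  T.η.app X

/-- The multiplication `m_X : T (T X) → T X`. -/
def tMult (T : Monad (Type u)) {X : Type u} : tObj T (tObj T X) → tObj T X :=
  T.μ.app X

theorem tMap_tMap (T : Monad (Type u)) {X Y Z : Type u} (g : Y → Z) (f : X → Y) (t : tObj T X) :
    tMap T g (tMap T f t) = tMap T (fun x => g (f x)) t :=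
  (congrArg (fun h => h t) (T.map_comp (↾f) (↾g))).symm

theorem tMap_id (T : Monad (Type u)) {X : Type u} (t : tObj T X) :
    tMap T (fun x : X => x) t = t :=
  congrArg (fun h => h t) (T.map_id X)

theorem tMap_tUnit (T : Monad (Type u)) {X Y : Type u} (f : X → Y) (x : X) :
    tMap T f (tUnit T x) = tUnit T (f x) :=
  (congrArg (fun h => h x) (T.η.naturality (↾f))).symm

/-- A commutative square of sets, with projections `p`, `q`, which is a weak pullback. -/
def IsWeakPullback {P A B C : Type u} (p : P → A) (q : P → B) (f : A → C) (g : B → C) : Prop :=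
  (∀ x, f (p x) = g (q x)) ∧ ∀ a b, f a = g b → ∃ x, p x = a ∧ q x = b

/-- The direct image `P_V f : V^X → V^Y`, left adjoint to `φ ↦ φ ∘ f`. -/
def directImage {V : Type u} [CompleteLattice V] {X Y : Type u} (f : X → Y) (φ : X → V) : Y → V :=
  fun y => ⨆ (x : X) (_ : f x = y), φ x

/-- `directImage f` is indeed left adjoint to the inverse image. -/
theorem directImage_gc {V : Type u} [CompleteLattice V] {X Y : Type u} (f : X → Y) :
    GaloisConnection (directImage (V := V) f) (fun φ : Y → V => φ ∘ f) := by
  intro φ χ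
  constructor
  · intro h x
    exact (le_iSup₂ (f := fun x' (_ : f x' = f x) => φ x') x rfl).trans (h (f x))
  · intro h y
    refine iSup₂_le ?_
    rintro x rfl
    exact h x

/-- A strict topological theory with underlying commutative quantale `V`. -/
structure StrictTheory (V : Type u) [CompleteLattice V] [CommMonoid V] [IsQuantale V] where
  /-- the monad on sets -/
  T : Monad (Type u)
  /-- the structure map -/
  ξ : tObj T V → V
  /-- `T` sends pullbacks to weak pullbacks -/
  map_pullback : ∀ {P A B C : Type u} (p : P → A) (q : P → B) (f : A → C) (g : B → C),
    IsPullback (↾p) (↾q) (↾f) (↾g) → IsWeakPullback (tMap T p) (tMap T q) (tMap T f) (tMap T g)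
  /-- the naturality squares of the multiplication are weak pullbacks -/
  mult_pullback : ∀ {X Y : Type u} (f : X → Y),
    IsWeakPullback (tMult T (X := X)) (tMap T (tMap T f)) (tMap T f) (tMult T (X := Y))
  /-- `(V, ξ)` is a `T`-algebra: unit law -/
  alg_unit : ∀ v : V, ξ (tUnit T v) = v
  /-- `(V, ξ)` is a `T`-algebra: associativity -/
  alg_assoc : ∀ w : tObj T (tObj T V), ξ (tMap T ξ w) = ξ (tMult T w)
  /-- the multiplication of `V` is a homomorphism of `T`-algebras -/
  alg_mul : ∀ w : tObj T (V × V),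
    ξ (tMap T (fun p : V × V => p.1 * p.2) w) = ξ (tMap T Prod.fst w) * ξ (tMap T Prod.snd w)
  /-- the unit of `V` is a homomorphism of `T`-algebras -/
  alg_one : ∀ t : tObj T PUnit.{u + 1}, ξ (tMap T (fun _ : PUnit => (1 : V)) t) = 1
  /-- `φ ↦ ξ · Tφ` is order-preserving -/
  xi_mono : ∀ {X : Type u} (φ χ : X → V), φ ≤ χ → ∀ t : tObj T X,
    ξ (tMap T φ t) ≤ ξ (tMap T χ t)
  /-- `φ ↦ ξ · Tφ` is natural with respect to direct images -/
  xi_natural : ∀ {X Y : Type u} (f : X → Y) (φ : X → V),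
    (fun t : tObj T Y => ξ (tMap T (directImage f φ) t)) =
      directImage (tMap T f) (fun s : tObj T X => ξ (tMap T φ s))

namespace StrictTheory

variable {V : Type u} [CompleteLattice V] [CommMonoid V] [IsQuantale V]

/-! ### `T`-matrices, `T`-graphs, `T`-categories, `T`-distributors

A `V`-matrix `X ⇸ Y` is a function `Y → X → V`; a `T`-matrix `X ⇸ Y` is a function
`T Y → X → V`. -/

/-- The extension of `T` to `V`-matrices. -/
def ext (𝕋 : StrictTheory V) {X Y : Type u} (r : Y → X → V) : tObj 𝕋.T Y → tObj 𝕋.T X → V :=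
  fun 𝔶 𝔵 => ⨆ (w : tObj 𝕋.T (Y × X)) (_ : tMap 𝕋.T Prod.fst w = 𝔶)
    (_ : tMap 𝕋.T Prod.snd w = 𝔵), 𝕋.ξ (tMap 𝕋.T (fun p : Y × X => r p.1 p.2) w)

/-- The Kleisli composite `β ∘ α = m · ext β · α` of `T`-matrices `α : X ⇸ Y`, `β : Y ⇸ Z`. -/
def kleisli (𝕋 : StrictTheory V) {X Y Z : Type u} (β : tObj 𝕋.T Z → Y → V)
    (α : tObj 𝕋.T Y → X → V) : tObj 𝕋.T Z → X → V :=
  fun 𝔷 x => ⨆ (W : tObj 𝕋.T (tObj 𝕋.T Z)) (_ : tMult 𝕋.T W = 𝔷) (𝔶 : tObj 𝕋.T Y),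
    𝕋.ext β W 𝔶 * α 𝔶 x

/-- A `T`-graph. -/
structure TGraph (𝕋 : StrictTheory V) where
  /-- the underlying set -/
  carrier : Type u
  /-- the structure matrix -/
  str : tObj 𝕋.T carrier → carrier → V
  /-- reflexivity -/
  refl : ∀ x, 1 ≤ str (tUnit 𝕋.T x) x

/-- A `T`-category. -/
structure TCat (𝕋 : StrictTheory V) extends TGraph 𝕋 where
  /-- transitivity -/
  trans : 𝕋.kleisli str str ≤ str

/-- `T`-graph morphisms; between `T`-categories these are the `T`-functors. -/
def IsGraphMor {𝕋 : StrictTheory V} (A B : TGraph 𝕋) (f : A.carrier → B.carrier) : Prop :=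
  ∀ (𝔵 : tObj 𝕋.T A.carrier) (x : A.carrier), A.str 𝔵 x ≤ B.str (tMap 𝕋.T f 𝔵) (f x)

/-- `T`-distributors `X ⇸ Y`. -/
def IsDist {𝕋 : StrictTheory V} (X Y : TCat 𝕋) (φ : tObj 𝕋.T Y.carrier → X.carrier → V) : Prop :=
  𝕋.kleisli φ X.str ≤ φ ∧ 𝕋.kleisli Y.str φ ≤ φ

/-- `φ ⊣ ψ` for `T`-distributors `φ : Y ⇸ X` and `ψ : X ⇸ Y`. -/
structure IsAdj {𝕋 : StrictTheory V} (Y X : TCat 𝕋) (φ : tObj 𝕋.T X.carrier → Y.carrier → V)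
    (ψ : tObj 𝕋.T Y.carrier → X.carrier → V) : Prop where
  left_dist : IsDist Y X φ
  right_dist : IsDist X Y ψ
  unit : Y.str ≤ 𝕋.kleisli ψ φ
  counit : 𝕋.kleisli φ ψ ≤ X.str

/-- The matrix `f_* : Y ⇸ X` of a function `f : Y → X`. -/
def lowerStar {𝕋 : StrictTheory V} (Y X : TCat 𝕋) (f : Y.carrier → X.carrier) :
    tObj 𝕋.T X.carrier → Y.carrier → V :=
  fun 𝔵 y => X.str 𝔵 (f y)

/-- The matrix `f^* : X ⇸ Y` of a function `f : Y → X`. -/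
def upperStar {𝕋 : StrictTheory V} (Y X : TCat 𝕋) (f : Y.carrier → X.carrier) :
    tObj 𝕋.T Y.carrier → X.carrier → V :=
  fun 𝔶 x => X.str (tMap 𝕋.T f 𝔶) x

/-- Cauchy completeness: every adjunction of `T`-distributors into `X` is induced by a
`T`-functor. -/
def IsCauchyComplete {𝕋 : StrictTheory V} (X : TCat 𝕋) : Prop :=
  ∀ (Y : TCat 𝕋) (φ : tObj 𝕋.T X.carrier → Y.carrier → V)
    (ψ : tObj 𝕋.T Y.carrier → X.carrier → V), IsAdj Y X φ ψ →
      ∃ f : Y.carrier → X.carrier,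
        IsGraphMor Y.toTGraph X.toTGraph f ∧ φ = lowerStar Y X f ∧ ψ = upperStar Y X f

/-- The one-point `T`-category `E`, with structure constant `k`. -/
abbrev unitCat (𝕋 : StrictTheory V) : TCat 𝕋 where
  carrier := PUnit
  str := fun _ _ => 1
  refl := fun _ => le_rfl
  trans := by
    intro 𝔷 x
    refine iSup_le fun W => iSup_le fun _ => iSup_le fun 𝔶 => ?_
    rw [mul_one]
    refine iSup_le fun w => iSup_le fun _ => iSup_le fun _ => ?_
    have h := 𝕋.alg_one (tMap 𝕋.T (fun _ => PUnit.unit) w)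
    rw [tMap_tMap] at h
    exact h.le

/-- The `T`-distributor `x_* : E ⇸ X` of a point `x` of `X`. -/
def pointStar {𝕋 : StrictTheory V} (X : TCat 𝕋) (x : X.carrier) :
    tObj 𝕋.T X.carrier → 𝕋.unitCat.carrier → V :=
  lowerStar 𝕋.unitCat X (fun _ => x)

/-- A `T`-distributor `E ⇸ X` that has a right adjoint. -/
def IsLeftAdj {𝕋 : StrictTheory V} (X : TCat 𝕋)
    (ψ : tObj 𝕋.T X.carrier → 𝕋.unitCat.carrier → V) : Prop :=
  ∃ φ : tObj 𝕋.T 𝕋.unitCat.carrier → X.carrier → V, IsAdj 𝕋.unitCat X ψ φ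

/-- The left adjoint `T`-distributors `E ⇸ X`, ordered pointwise: the objects of the
Cauchy completion of `X`. -/
abbrev LeftAdj {𝕋 : StrictTheory V} (X : TCat 𝕋) : Type u :=
  {ψ : tObj 𝕋.T X.carrier → 𝕋.unitCat.carrier → V // IsLeftAdj X ψ}

/-! ### `V` as a `T`-graph, `T`-algebras as `T`-graphs, the `T`-graph `V^X` -/

/-- The quantale `V` with structure `(𝔳, v) ↦ hom (ξ 𝔳, v)`. -/
abbrev graphV (𝕋 : StrictTheory V) : TGraph 𝕋 where
  carrier := V
  str := fun 𝔳 v => qhom (𝕋.ξ 𝔳) v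
  refl := by
    intro v
    rw [le_qhom_iff, one_mul, 𝕋.alg_unit]

/-- A `T`-algebra `(I, α)` as a `T`-graph: the structure is `k` if `α 𝔦 = i`, else `⊥`. -/
abbrev graphAlg (𝕋 : StrictTheory V) (I : 𝕋.T.Algebra) : TGraph 𝕋 where
  carrier := I.A
  str := fun 𝔦 i => ⨆ (_ : I.a 𝔦 = i), (1 : V)
  refl := by
    intro x
    have h : I.a (𝕋.T.η.app I.A x) = x := by
      rw [← ConcreteCategory.comp_apply, I.unit]
      rfl
    exact le_iSup_of_le h le_rfl

/-- The set of `T`-graph morphisms `X → V`. -/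
abbrev PowerCarrier {𝕋 : StrictTheory V} (X : TGraph 𝕋) : Type u :=
  {φ : X.carrier → V // IsGraphMor X 𝕋.graphV φ}

/-- The exponential `T`-graph `V^X`. -/
abbrev power {𝕋 : StrictTheory V} (X : TGraph 𝕋) : TGraph 𝕋 where
  carrier := PowerCarrier X
  str := fun 𝔭 φ => ⨅ (𝔮 : tObj 𝕋.T (X.carrier × PowerCarrier X))
    (_ : tMap 𝕋.T Prod.snd 𝔮 = 𝔭) (x : X.carrier),
      qhom (X.str (tMap 𝕋.T Prod.fst 𝔮) x)
        (qhom (𝕋.ξ (tMap 𝕋.T (fun p : X.carrier × PowerCarrier X => p.2.1 p.1) 𝔮)) (φ.1 x))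
  refl := by
    intro φ
    refine le_iInf fun 𝔮 => le_iInf fun h𝔮 => le_iInf fun x => ?_
    rw [le_qhom_iff, one_mul, le_qhom_iff]
    have hp : IsPullback (↾(fun x : X.carrier => (x, φ))) (↾(fun _ : X.carrier => PUnit.unit.{u + 1}))
        (↾(Prod.snd : X.carrier × PowerCarrier X → PowerCarrier X))
        (↾(fun _ : PUnit.{u + 1} => φ)) := by
      rw [Limits.Types.isPullback_iff]
      refine ⟨rfl, ?_, ?_⟩
      · intro a b h
        exact congrArg Prod.fst h.1
      · rintro ⟨a, χ⟩ b h
        have h' : χ = φ := h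
        subst h'
        exact ⟨a, rfl, rfl⟩
    have hn : tMap 𝕋.T (fun _ : PUnit.{u + 1} => φ) (tUnit 𝕋.T PUnit.unit) = tUnit 𝕋.T φ :=
      tMap_tUnit _ _ _
    obtain ⟨𝔵, rfl, -⟩ := (𝕋.map_pullback _ _ _ _ hp).2 𝔮 (tUnit 𝕋.T PUnit.unit)
      (h𝔮.trans hn.symm)
    rw [tMap_tMap, tMap_tMap, tMap_id, ← le_qhom_iff]
    exact φ.2 𝔵 x

/-! ### `V`-categories, weighted limits and colimits -/

/-- `c` is a `V`-category structure. -/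
def IsVCat {A : Type u} (c : A → A → V) : Prop :=
  (∀ x, 1 ≤ c x x) ∧ ∀ x y z, c x y * c y z ≤ c x z

/-- `f` is a `V`-functor. -/
def IsVFun {A B : Type u} (c : A → A → V) (d : B → B → V) (f : A → B) : Prop :=
  ∀ x y, c x y ≤ d (f x) (f y)

/-- `ψ` is a distributor `1 ⇸ A` (a contravariant presheaf, a weight for colimits). -/
def IsPresheaf {A : Type u} (c : A → A → V) (ψ : A → V) : Prop :=
  ∀ x y, c x y * ψ y ≤ ψ x

/-- `φ` is a distributor `A ⇸ 1` (a covariant presheaf, a weight for limits). -/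
def IsCopresheaf {A : Type u} (c : A → A → V) (φ : A → V) : Prop :=
  ∀ x y, φ x * c x y ≤ φ y

/-- `l` is a limit of `h` weighted by `φ`. -/
def IsWLimit {A I : Type u} (c : A → A → V) (φ : I → V) (h : I → A) (l : A) : Prop :=
  ∀ y, c y l = ⨅ i, qhom (φ i) (c y (h i))

/-- `l` is a colimit of `h` weighted by `ψ`. -/
def IsWColimit {A I : Type u} (c : A → A → V) (ψ : I → V) (h : I → A) (l : A) : Prop :=
  ∀ y, c l y = ⨅ i, qhom (ψ i) (c (h i) y)

/-- `t` is a tensor of `v` and `a`. -/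
def IsTensor {A : Type u} (c : A → A → V) (v : V) (a t : A) : Prop :=
  ∀ y, c t y = qhom v (c a y)

/-- `s` is a supremum of the presheaf `ψ`. -/
def IsSupremum {A : Type u} (c : A → A → V) (ψ : A → V) (s : A) : Prop :=
  IsWColimit c ψ (fun a => a) s

/-- The structure of the presheaf `V`-category `P A`. -/
def presheafHom {A : Type u} (ψ χ : A → V) : V := ⨅ a, qhom (ψ a) (χ a)

/-- The presheaf `V`-category `P A`: its underlying set. -/
abbrev Presheaf {A : Type u} (c : A → A → V) : Type u := {ψ : A → V // IsPresheaf c ψ}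

/-! ### `T`-frames -/

/-- The `V`-graph underlying a `T`-graph. -/
def TGraph.hom {𝕋 : StrictTheory V} (A : TGraph 𝕋) (x y : A.carrier) : V :=
  A.str (tUnit 𝕋.T x) y

/-- `(I, r, h, ψ)` is a `T`-weighted diagram in `A`: `r` is a `V`-category structure on the
`T`-algebra `I`, `h` a `V`-functor, `ψ` a weight, and `i ↦ ψ i ⊗ h i` a `T`-graph morphism. -/
structure IsTWeighted {𝕋 : StrictTheory V} (A : TGraph 𝕋) (I : 𝕋.T.Algebra)
    (r : I.A → I.A → V) (h : I.A → A.carrier) (ψ : I.A → V) : Prop where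
  vcat : IsVCat r
  vfun : IsVFun r A.hom h
  weight : IsPresheaf r ψ
  tensor : ∃ g : I.A → A.carrier,
    (∀ i, IsTensor A.hom (ψ i) (h i) (g i)) ∧ IsGraphMor (𝕋.graphAlg I) A g

/-- `T`-generated presheaves: those of the form `h_* · ψ` for a `T`-weighted diagram. -/
def IsTGenerated {𝕋 : StrictTheory V} (A : TGraph 𝕋) (χ : A.carrier → V) : Prop :=
  ∃ (I : 𝕋.T.Algebra) (r : I.A → I.A → V) (h : I.A → A.carrier) (ψ : I.A → V),
    IsTWeighted A I r h ψ ∧ ∀ a, χ a = ⨆ i, A.hom a (h i) * ψ i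

/-- `T`-frames: complete `V`-categories underlying a `T`-graph, in which suprema of
`T`-generated presheaves distribute over weighted limits. -/
structure IsTFrame {𝕋 : StrictTheory V} (A : TGraph 𝕋) : Prop where
  vcat : IsVCat A.hom
  complete : ∀ (I : Type u) (r : I → I → V) (φ : I → V) (h : I → A.carrier),
    IsVCat r → IsCopresheaf r φ → IsVFun r A.hom h → ∃ l, IsWLimit A.hom φ h l
  distrib : ∀ (I : Type u) (r : I → I → V) (φ : I → V) (h : I → Presheaf A.hom)
    (L : Presheaf A.hom), IsVCat r → IsCopresheaf r φ →
    IsVFun r (fun ψ χ : Presheaf A.hom => presheafHom ψ.1 χ.1) h →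
    (∀ i, IsTGenerated A (h i).1) →
    IsWLimit (fun ψ χ : Presheaf A.hom => presheafHom ψ.1 χ.1) φ h L →
    IsTGenerated A L.1 →
    ∀ (s : I → A.carrier) (l : A.carrier), (∀ i, IsSupremum A.hom (h i).1 (s i)) →
      IsSupremum A.hom L.1 l → IsWLimit A.hom φ s l

/-- `T`-frame homomorphisms: `T`-compatible `V`-functors that preserve weighted limits and
`T`-weighted colimits. -/
structure IsTFrameHom {𝕋 : StrictTheory V} (A B : TGraph 𝕋) (f : A.carrier → B.carrier) :
    Prop where
  vfun : IsVFun A.hom B.hom f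
  compat : ∀ (I : 𝕋.T.Algebra) (h : I.A → A.carrier),
    IsGraphMor (𝕋.graphAlg I) A h → IsGraphMor (𝕋.graphAlg I) B (fun i => f (h i))
  limits : ∀ (I : Type u) (r : I → I → V) (φ : I → V) (h : I → A.carrier) (l : A.carrier),
    IsVCat r → IsCopresheaf r φ → IsVFun r A.hom h →
    IsWLimit A.hom φ h l → IsWLimit B.hom φ (fun i => f (h i)) (f l)
  tcolimits : ∀ (I : 𝕋.T.Algebra) (r : I.A → I.A → V) (h : I.A → A.carrier) (ψ : I.A → V)
    (l : A.carrier), IsTWeighted A I r h ψ →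
    IsWColimit A.hom ψ h l → IsWColimit B.hom ψ (fun i => f (h i)) (f l)

/-- The `T`-frame `Ω X` of `T`-functors `X → V`. -/
abbrev Omega {𝕋 : StrictTheory V} (X : TCat 𝕋) : TGraph 𝕋 := power X.toTGraph

/-- The points of `Ω X`: `T`-frame homomorphisms `Ω X → V`, ordered pointwise. -/
abbrev Points {𝕋 : StrictTheory V} (X : TCat 𝕋) : Type u :=
  {Φ : PowerCarrier X.toTGraph → V // IsTFrameHom (Omega X) 𝕋.graphV Φ}

/-- The evaluation `ev_x : Ω X → V`. -/
def evalAt {𝕋 : StrictTheory V} (X : TCat 𝕋) (x : X.carrier) : PowerCarrier X.toTGraph → V :=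
  fun φ => φ.1 x

end StrictTheory

end

/-!
Everything rests on a description of `Ω X` in pointwise terms. Since `T 1 = 1`, constants can be
moved through `φ ↦ ξ · T φ` (`lift_const_mul`), so weighted limits and tensors in `Ω X` are computed
pointwise, as is the underlying `V`-category (`le_omega_hom_iff`). By naturality with respect to
direct images, `ξ · T` of a supremum is a supremum over `T (X × I)` (`lift_iSup`), and the graph
morphism condition on a `T`-weighted diagram says exactly that its pointwise colimit is again a
`T`-functor (`IsTWeighted.colimit_apply`). Moreover `a(e x, -)` belongs to `Ω X` and represents the
evaluation at `x`; consequently the supremum of a `T`-generated presheaf `χ` is the function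
`x ↦ χ (a(e x, -))` (`IsTGenerated.supremum_apply`). As limits of presheaves are pointwise too, such
suprema distribute over limits, and `Ω X` is a `T`-frame. In `V` the same argument uses that every
presheaf `χ` has supremum `χ 1`.

An adjunction `ψ ⊣ φ` between `E` and `X` amounts to a pair of functions `p` on `T X` and `q` on `X`
(`IsPointAdj`). The point attached to it is `θ ↦ ⨆ t, ξ (T θ t) * p t`, composition with `p`, and the
adjunction identifies it with `[q, -]` (`IsPointAdj.le_pairing_iff`). From the second description it
preserves limits; from the first, `T`-colimits and `T`-compatibility. For the latter, the strength
`I × T X → T (X × I)` of the monad turns the iterated extension into a single one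
(`IsPointAdj.lift_pairing_le`).

Conversely, a point `Φ` preserves limits and so is represented by some `q`
(`IsTFrameHom.exists_hom_eq`); put `p t = Φ (a(t, -))`. Each `θ` in `Ω X` is the `T`-colimit of the
functions `a(t, -)`, indexed by the free algebra `T X` and weighted by `ξ · T θ`
(`isTWeighted_corepr`, `isWColimit_corepr`). Applied to `q`, preservation of this colimit gives the
unit of `p ⊣ q`, and compatibility of `Φ` with `t ↦ a(t, -)` makes `p` a distributor.

For Cauchy completeness, an adjunction `φ ⊣ ψ` from an arbitrary `Y` restricts to an adjunction from
`E` at each `y` (`IsAdj.isPointAdj`). If all of these are of the form `x_*`, the chosen `x` depend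
on `y` by a `T`-functor which induces `φ ⊣ ψ` (`IsAdj.eq_star`).
-/

/-! ### The functor `T` under the hypothesis `T 1 = 1` -/

section Monad

variable (T : Monad (Type u))

theorem tMult_tUnit {X : Type u} (t : tObj T X) : tMult T (tUnit T t) = t :=
  congrArg (fun h => h t) (T.left_unit X)

theorem tMult_tMap_tUnit {X : Type u} (t : tObj T X) :
    tMult T (tMap T (fun x => tUnit T x) t) = t :=
  congrArg (fun h => h t) (T.right_unit X)

theorem tMult_natural {X Y : Type u} (f : X → Y) (W : tObj T (tObj T X)) :
    tMult T (tMap T (fun t => tMap T f t) W) = tMap T f (tMult T W) :=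
  congrArg (fun h => h W) (T.μ.naturality (↾f))

theorem tMap_const [Subsingleton (tObj T PUnit.{u + 1})] {X Y : Type u} (y : Y) (t : tObj T X) :
    tMap T (fun _ => y) t = tUnit T y := by
  have h := tMap_tUnit T (fun _ : PUnit.{u + 1} => y) PUnit.unit
  rw [← h, ← Subsingleton.elim (tMap T (fun _ => PUnit.unit) t) (tUnit T PUnit.unit), tMap_tMap]

instance [Subsingleton (tObj T PUnit.{u + 1})] : Subsingleton (tObj T (tObj T PUnit.{u + 1})) := by
  refine ⟨fun W W' => ?_⟩
  have key : ∀ W : tObj T (tObj T PUnit.{u + 1}), W = tUnit T (tUnit T PUnit.unit) := by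
    intro W
    rw [← tMap_const T (tUnit T PUnit.unit) W]
    conv_lhs => rw [← tMap_id T W]
    exact congrArg (fun f => tMap T f W) (funext fun _ => Subsingleton.elim _ _)
  rw [key W, key W']

end Monad

namespace StrictTheory

variable {V : Type u} [CompleteLattice V] [CommMonoid V] [IsQuantale V] (𝕋 : StrictTheory V)

/-- An element of `T (X × Y)` whose second component comes from `T I` along `g : I → Y` comes itself
from `T (X × I)`, because `X × I` is the pullback of `X × Y` along `g`. -/
theorem exists_lift_snd {X Y I : Type u} (g : I → Y) (q : tObj 𝕋.T (X × Y)) (i : tObj 𝕋.T I)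
    (hq : tMap 𝕋.T Prod.snd q = tMap 𝕋.T g i) :
    ∃ q' : tObj 𝕋.T (X × I), tMap 𝕋.T (fun p => (p.1, g p.2)) q' = q ∧
      tMap 𝕋.T Prod.snd q' = i := by
  have hp : IsPullback (↾(fun p : X × I => (p.1, g p.2))) (↾(Prod.snd : X × I → I))
      (↾(Prod.snd : X × Y → Y)) (↾g) := by
    rw [Limits.Types.isPullback_iff]
    refine ⟨rfl, ?_, ?_⟩
    · rintro ⟨a, i⟩ ⟨b, j⟩ h
      have h1 : (a, g i) = (b, g j) := h.1
      have h2 : i = j := h.2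
      rw [(Prod.mk.inj h1).1, h2]
    · rintro ⟨a, y⟩ i h
      have h' : y = g i := h
      subst h'
      exact ⟨(a, i), rfl, rfl⟩
  exact (𝕋.map_pullback _ _ _ _ hp).2 q i hq

/-! ### The extension `ξ · T φ` of a function `φ : X → V` to `T X` -/

/-- The function `ξ · T φ : T X → V`, the extension of `φ : X → V` to `T X`. -/
def lift {X : Type u} (φ : X → V) (t : tObj 𝕋.T X) : V := 𝕋.ξ (tMap 𝕋.T φ t)

variable {𝕋}

theorem lift_tMap {X Y : Type u} (φ : Y → V) (f : X → Y) (t : tObj 𝕋.T X) :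
    𝕋.lift φ (tMap 𝕋.T f t) = 𝕋.lift (fun x => φ (f x)) t := by
  rw [lift, tMap_tMap, lift]

theorem lift_tUnit {X : Type u} (φ : X → V) (x : X) : 𝕋.lift φ (tUnit 𝕋.T x) = φ x := by
  rw [lift, tMap_tUnit, 𝕋.alg_unit]

theorem lift_mono {X : Type u} {φ χ : X → V} (h : ∀ x, φ x ≤ χ x) (t : tObj 𝕋.T X) :
    𝕋.lift φ t ≤ 𝕋.lift χ t :=
  𝕋.xi_mono φ χ h t

theorem lift_mul {X : Type u} (φ χ : X → V) (t : tObj 𝕋.T X) :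
    𝕋.lift (fun x => φ x * χ x) t = 𝕋.lift φ t * 𝕋.lift χ t := by
  have h := 𝕋.alg_mul (tMap 𝕋.T (fun x => (φ x, χ x)) t)
  rwa [tMap_tMap, tMap_tMap, tMap_tMap] at h

/-- Associativity of the algebra `(V, ξ)`. -/
theorem lift_lift {X : Type u} (φ : X → V) (W : tObj 𝕋.T (tObj 𝕋.T X)) :
    𝕋.lift (𝕋.lift φ) W = 𝕋.lift φ (tMult 𝕋.T W) := by
  have h := 𝕋.alg_assoc (tMap 𝕋.T (fun t => tMap 𝕋.T φ t) W)
  rw [tMap_tMap, tMult_natural] at h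
  exact h

/-- Naturality with respect to direct images along `X × I → X`: a supremum of functions is extended
by a supremum over `T (X × I)`. -/
theorem lift_iSup {X I : Type u} (g : X × I → V) (t : tObj 𝕋.T X) :
    𝕋.lift (fun x => ⨆ i, g (x, i)) t =
      ⨆ (q : tObj 𝕋.T (X × I)) (_ : tMap 𝕋.T Prod.fst q = t), 𝕋.lift g q := by
  have h := congrFun (𝕋.xi_natural (Prod.fst : X × I → X) g) t
  have e : directImage (Prod.fst : X × I → X) g = fun x => ⨆ i, g (x, i) := by
    funext x
    refine le_antisymm (iSup₂_le ?_) (iSup_le fun i => le_iSup₂_of_le (x, i) rfl le_rfl)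
    rintro ⟨_, i⟩ rfl
    exact le_iSup (fun i => g (_, i)) i
  rw [e] at h
  exact h

theorem mul_lift_iSup_le {X I : Type u} {g : X × I → V} {t : tObj 𝕋.T X} {v w : V}
    (h : ∀ q : tObj 𝕋.T (X × I), tMap 𝕋.T Prod.fst q = t → v * 𝕋.lift g q ≤ w) :
    v * 𝕋.lift (fun x => ⨆ i, g (x, i)) t ≤ w := by
  rw [mul_comm, ← le_qhom_iff, lift_iSup]
  refine iSup₂_le fun q hq => ?_
  rw [le_qhom_iff, mul_comm]
  exact h q hq

section

variable [Subsingleton (tObj 𝕋.T PUnit.{u + 1})]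

theorem lift_const {X : Type u} (v : V) (t : tObj 𝕋.T X) : 𝕋.lift (fun _ => v) t = v := by
  rw [lift, tMap_const, 𝕋.alg_unit]

theorem lift_const_mul {X : Type u} (v : V) (φ : X → V) (t : tObj 𝕋.T X) :
    𝕋.lift (fun x => v * φ x) t = v * 𝕋.lift φ t := by
  rw [lift_mul (fun _ => v) φ, lift_const]

end

/-! ### The extension of matrices and Kleisli composition -/

theorem ext_eq {X Y : Type u} (r : Y → X → V) (t : tObj 𝕋.T Y) (s : tObj 𝕋.T X) :
    𝕋.ext r t s = ⨆ (w : tObj 𝕋.T (Y × X)) (_ : tMap 𝕋.T Prod.fst w = t)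
      (_ : tMap 𝕋.T Prod.snd w = s), 𝕋.lift (fun p => r p.1 p.2) w :=
  rfl

theorem lift_le_ext {X Y I : Type u} (r : Y → X → V) (f : I → Y) (g : I → X) (w : tObj 𝕋.T I) :
    𝕋.lift (fun i => r (f i) (g i)) w ≤ 𝕋.ext r (tMap 𝕋.T f w) (tMap 𝕋.T g w) := by
  rw [ext_eq]
  refine le_iSup_of_le (tMap 𝕋.T (fun i => (f i, g i)) w) ?_
  refine le_iSup₂_of_le (tMap_tMap _ _ _ _) (tMap_tMap _ _ _ _) ?_
  rw [lift_tMap]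

theorem ext_le_lift_left {A B : Type u} (p : B → V) (t : tObj 𝕋.T B) (s : tObj 𝕋.T A) :
    𝕋.ext (fun b _ => p b) t s ≤ 𝕋.lift p t := by
  refine iSup_le fun w => iSup₂_le fun h1 _ => ?_
  rw [← h1, lift_tMap]
  exact le_rfl

theorem ext_le_lift_right {A B : Type u} (q : A → V) (t : tObj 𝕋.T B) (s : tObj 𝕋.T A) :
    𝕋.ext (fun _ a => q a) t s ≤ 𝕋.lift q s := by
  refine iSup_le fun w => iSup₂_le fun _ h2 => ?_
  rw [← h2, lift_tMap]
  exact le_rfl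

/-- Over a unit `e y` the extension of a matrix is computed by its row at `y`: elements of
`T (Y × X)` over `e y` come from `T X`. -/
theorem ext_tUnit_left [Subsingleton (tObj 𝕋.T PUnit.{u + 1})] {X Y : Type u} (r : Y → X → V)
    (y : Y) (s : tObj 𝕋.T X) :
    𝕋.ext r (tUnit 𝕋.T y) s = 𝕋.lift (r y) s := by
  refine le_antisymm (iSup_le fun w => iSup₂_le fun h1 h2 => ?_) ?_
  · obtain ⟨q', hq', -⟩ := 𝕋.exists_lift_snd (fun _ : PUnit.{u + 1} => y)
      (tMap 𝕋.T (fun p => (p.2, p.1)) w) (tUnit 𝕋.T PUnit.unit) (by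
        rw [tMap_tMap, tMap_tUnit]; exact h1)
    have hs : tMap 𝕋.T Prod.fst q' = s := by
      rw [← h2]
      have := congrArg (tMap 𝕋.T Prod.fst) hq'
      rwa [tMap_tMap, tMap_tMap] at this
    have := congrArg (𝕋.lift (fun p => r p.2 p.1)) hq'
    rw [lift_tMap, lift_tMap] at this
    rw [← hs, lift_tMap]
    exact this.ge
  · have h := lift_le_ext r (fun _ : X => y) (fun x => x) s
    rwa [tMap_const, tMap_id] at h

theorem lift_le_ext_tUnit_right [Subsingleton (tObj 𝕋.T PUnit.{u + 1})] {X Y : Type u}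
    (r : Y → X → V) (t : tObj 𝕋.T Y) (x : X) :
    𝕋.lift (fun y => r y x) t ≤ 𝕋.ext r t (tUnit 𝕋.T x) := by
  have h := lift_le_ext r (fun y : Y => y) (fun _ => x) t
  rwa [tMap_const, tMap_id] at h

theorem kleisli_le_iff {X Y Z : Type u} {β : tObj 𝕋.T Z → Y → V} {α : tObj 𝕋.T Y → X → V}
    {γ : tObj 𝕋.T Z → X → V} :
    𝕋.kleisli β α ≤ γ ↔ ∀ W t x, 𝕋.ext β W t * α t x ≤ γ (tMult 𝕋.T W) x := by
  constructor
  · intro h W t x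
    exact le_trans (le_iSup_of_le W (le_iSup_of_le rfl
      (le_iSup (fun t => 𝕋.ext β W t * α t x) t))) (h _ x)
  · intro h z x
    refine iSup_le fun W => iSup_le fun hW => iSup_le fun t => ?_
    rw [← hW]
    exact h W t x

/-- Since `T 1 = 1` and the naturality squares of the multiplication are weak pullbacks, the
only element of `T (T X)` over `e x` is `e (e x)`. -/
theorem eq_tUnit_of_tMult_eq [Subsingleton (tObj 𝕋.T PUnit.{u + 1})] {X : Type u} {x : X}
    {W : tObj 𝕋.T (tObj 𝕋.T X)} (h : tMult 𝕋.T W = tUnit 𝕋.T x) :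
    W = tUnit 𝕋.T (tUnit 𝕋.T x) := by
  obtain ⟨W', -, hW⟩ := (𝕋.mult_pullback (fun _ : PUnit.{u + 1} => x)).2
    (tUnit 𝕋.T PUnit.unit) W (by rw [tMap_tUnit, h])
  rw [← hW, Subsingleton.elim W' (tUnit 𝕋.T (tUnit 𝕋.T PUnit.unit)), tMap_tUnit, tMap_tUnit]

theorem kleisli_tUnit [Subsingleton (tObj 𝕋.T PUnit.{u + 1})] {X Y Z : Type u}
    (β : tObj 𝕋.T Z → Y → V) (α : tObj 𝕋.T Y → X → V) (z : Z) (x : X) :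
    𝕋.kleisli β α (tUnit 𝕋.T z) x = ⨆ t, 𝕋.lift (β (tUnit 𝕋.T z)) t * α t x := by
  refine le_antisymm (iSup_le fun W => iSup_le fun hW => iSup_mono fun t => ?_)
    (iSup_le fun t => ?_)
  · rw [eq_tUnit_of_tMult_eq hW, ext_tUnit_left]
  · refine le_iSup_of_le _ (le_iSup_of_le (tMult_tUnit 𝕋.T _) (le_iSup_of_le t ?_))
    rw [ext_tUnit_left]

/-! ### `T`-functors `X → V` and the `T`-graph `Ω X` -/

theorem isGraphMor_graphV_iff {A : TGraph 𝕋} {φ : A.carrier → V} :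
    IsGraphMor A 𝕋.graphV φ ↔ ∀ t x, A.str t x * 𝕋.lift φ t ≤ φ x :=
  forall₂_congr fun _ _ => le_qhom_iff

theorem isGraphMor_graphAlg_iff {I : 𝕋.T.Algebra} {B : TGraph 𝕋} {g : I.A → B.carrier} :
    IsGraphMor (𝕋.graphAlg I) B g ↔ ∀ t, 1 ≤ B.str (tMap 𝕋.T g t) (g (I.a t)) := by
  constructor
  · intro h t
    exact (le_iSup_of_le (f := fun _ : I.a t = I.a t => (1 : V)) rfl le_rfl).trans (h t _)
  · intro h t i
    refine iSup_le fun hi => ?_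
    rw [← hi]
    exact h t

theorem isGraphMor_graphAlg_graphV_iff {I : 𝕋.T.Algebra} {g : I.A → V} :
    IsGraphMor (𝕋.graphAlg I) 𝕋.graphV g ↔ ∀ t, 𝕋.lift g t ≤ g (I.a t) := by
  rw [isGraphMor_graphAlg_iff]
  refine forall_congr' fun t => ?_
  rw [le_qhom_iff, one_mul]
  rfl

variable {X : TCat 𝕋}

theorem one_le_omega_str_iff {t : tObj 𝕋.T (PowerCarrier X.toTGraph)}
    {φ : PowerCarrier X.toTGraph} :
    1 ≤ (Omega X).str t φ ↔ ∀ q : tObj 𝕋.T (X.carrier × PowerCarrier X.toTGraph),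
      tMap 𝕋.T Prod.snd q = t → ∀ x,
        X.str (tMap 𝕋.T Prod.fst q) x * 𝕋.lift (fun p => p.2.1 p.1) q ≤ φ.1 x := by
  simp only [le_iInf_iff, le_qhom_iff, one_mul]
  rfl

/-- A family `g` of `T`-functors `X → V` indexed by a `T`-algebra `I` is a `T`-graph morphism into
`Ω X` exactly when its transpose `X × I → V` is one. -/
theorem isGraphMor_graphAlg_omega_iff {I : 𝕋.T.Algebra} {g : I.A → PowerCarrier X.toTGraph} :
    IsGraphMor (𝕋.graphAlg I) (Omega X) g ↔ ∀ (q : tObj 𝕋.T (X.carrier × I.A)) (x : X.carrier),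
      X.str (tMap 𝕋.T Prod.fst q) x * 𝕋.lift (fun p => (g p.2).1 p.1) q
        ≤ (g (I.a (tMap 𝕋.T Prod.snd q))).1 x := by
  rw [isGraphMor_graphAlg_iff]
  constructor
  · intro h q x
    have h1 := one_le_omega_str_iff.1 (h (tMap 𝕋.T Prod.snd q))
      (tMap 𝕋.T (fun p => (p.1, g p.2)) q) (by rw [tMap_tMap, tMap_tMap]) x
    rwa [tMap_tMap, lift_tMap] at h1
  · intro h t
    refine one_le_omega_str_iff.2 fun q hq x => ?_
    obtain ⟨q', rfl, rfl⟩ := 𝕋.exists_lift_snd g q t hq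
    rw [tMap_tMap, lift_tMap]
    exact h q' x

/-! ### Presheaves on a `V`-category -/

/-- Limits of presheaves are computed pointwise. -/
theorem isWLimit_presheaf_apply {A I : Type u} {c : A → A → V} (hc : IsVCat c) {φ : I → V}
    {h : I → Presheaf c} {L : Presheaf c}
    (hL : IsWLimit (fun ψ χ : Presheaf c => presheafHom ψ.1 χ.1) φ h L) (a : A) :
    L.1 a = ⨅ i, qhom (φ i) ((h i).1 a) := by
  have yoneda : ∀ χ : Presheaf c, presheafHom (fun b => c b a) χ.1 = χ.1 a := by
    intro χ
    refine le_antisymm ((iInf_le _ a).trans ?_) (le_iInf fun b => ?_)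
    · calc qhom (c a a) (χ.1 a) = qhom (c a a) (χ.1 a) * 1 := (mul_one _).symm
        _ ≤ qhom (c a a) (χ.1 a) * c a a := mul_le_mul_right (hc.1 a) _
        _ ≤ χ.1 a := le_qhom_iff.1 le_rfl
    · rw [le_qhom_iff, mul_comm]
      exact χ.2 b a
  have h1 := hL ⟨fun b => c b a, fun x y => hc.2 x y a⟩
  simp only [yoneda] at h1
  exact h1

/-- A supremum of the presheaf generated by a weighted diagram is a colimit of that diagram. -/
theorem IsSupremum.isWColimit {A I : Type u} {c : A → A → V} (hc : IsVCat c) {χ : A → V}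
    {h : I → A} {ψ : I → V} (hχ : ∀ a, χ a = ⨆ i, c a (h i) * ψ i) {s : A}
    (hs : IsSupremum c χ s) : IsWColimit c ψ h s := by
  intro y
  rw [hs y]
  refine eq_of_forall_le_iff fun v => ?_
  simp only [le_iInf_iff, le_qhom_iff]
  constructor
  · intro H i
    refine le_trans (mul_le_mul_right ?_ v) (H (h i))
    rw [hχ]
    refine le_trans ?_ (le_iSup _ i)
    calc ψ i = 1 * ψ i := (one_mul _).symm
      _ ≤ c (h i) (h i) * ψ i := mul_le_mul_left (hc.1 _) _
  · intro H a
    rw [hχ, Quantale.mul_iSup_distrib]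
    refine iSup_le fun i => ?_
    calc v * (c a (h i) * ψ i) = c a (h i) * (v * ψ i) := mul_left_comm _ _ _
      _ ≤ c a (h i) * c (h i) y := mul_le_mul_right (H i) _
      _ ≤ c a y := hc.2 _ _ _

/-! ### The `T`-frame `V` -/

theorem le_graphV_hom_iff {u v w : V} : u ≤ 𝕋.graphV.hom v w ↔ u * v ≤ w := by
  have h : 𝕋.graphV.hom v w = qhom v w := congrArg (fun z => qhom z w) (𝕋.alg_unit v)
  rw [h, le_qhom_iff]

theorem graphV_one_hom (v : V) : 𝕋.graphV.hom 1 v = v :=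
  eq_of_forall_le_iff fun u => by rw [le_graphV_hom_iff, mul_one]

theorem isVCat_graphV : IsVCat 𝕋.graphV.hom := by
  refine ⟨fun v => le_graphV_hom_iff.2 (one_mul v).le, fun u v w => ?_⟩
  rw [le_graphV_hom_iff]
  calc 𝕋.graphV.hom u v * 𝕋.graphV.hom v w * u
      = 𝕋.graphV.hom v w * (𝕋.graphV.hom u v * u) := by ac_rfl
    _ ≤ 𝕋.graphV.hom v w * v := mul_le_mul_right (le_graphV_hom_iff.1 le_rfl) _
    _ ≤ w := le_graphV_hom_iff.1 le_rfl

theorem isWLimit_graphV_iff {I : Type u} {φ : I → V} {h : I → V} {l : V} :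
    IsWLimit 𝕋.graphV.hom φ h l ↔ l = ⨅ i, qhom (φ i) (h i) := by
  constructor
  · intro H
    have h1 := H (1 : V)
    simpa only [graphV_one_hom] using h1
  · rintro rfl y
    refine eq_of_forall_le_iff fun v => ?_
    simp only [le_graphV_hom_iff, le_iInf_iff, le_qhom_iff, mul_right_comm v y]

theorem isWColimit_graphV_iff {I : Type u} {ψ : I → V} {h : I → V} {l : V} :
    IsWColimit 𝕋.graphV.hom ψ h l ↔ l = ⨆ i, ψ i * h i := by
  have key : ∀ v y : V, v ≤ (⨅ i, qhom (ψ i) (𝕋.graphV.hom (h i) y)) ↔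
      v * (⨆ i, ψ i * h i) ≤ y := by
    intro v y
    simp only [le_graphV_hom_iff, le_iInf_iff, le_qhom_iff, Quantale.mul_iSup_distrib, iSup_le_iff,
      mul_assoc]
  constructor
  · intro H
    refine eq_of_forall_ge_iff fun y => ?_
    have h1 := key 1 y
    rwa [← H y, le_graphV_hom_iff, one_mul, one_mul] at h1
  · rintro rfl y
    exact eq_of_forall_le_iff fun v => by rw [key, le_graphV_hom_iff]

/-- Every presheaf on `V` has its value at `1` as supremum, so that taking suprema preserves all
limits. -/
theorem IsSupremum.eq_apply_one {χ : V → V} (hχ : IsPresheaf 𝕋.graphV.hom χ) {s : V}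
    (hs : IsSupremum 𝕋.graphV.hom χ s) : s = χ 1 := by
  rw [IsSupremum, isWColimit_graphV_iff] at hs
  rw [hs]
  refine le_antisymm (iSup_le fun v => ?_) ((mul_one (χ 1)).ge.trans
    (le_iSup (fun v => χ v * v) 1))
  have h := hχ 1 v
  rwa [graphV_one_hom, mul_comm] at h

variable (𝕋) in
theorem isTFrame_graphV : IsTFrame 𝕋.graphV where
  vcat := isVCat_graphV
  complete _ _ _ _ _ _ _ := ⟨_, isWLimit_graphV_iff.2 rfl⟩
  distrib I r φ h L _ _ _ _ hL _ s l hs hl := by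
    rw [isWLimit_graphV_iff, hl.eq_apply_one L.2, isWLimit_presheaf_apply isVCat_graphV hL]
    exact iInf_congr fun i => by rw [(hs i).eq_apply_one (h i).2]

/-! ### Limits and `T`-colimits in `Ω X` -/

theorem str_mul_lift_le (φ : PowerCarrier X.toTGraph) (t : tObj 𝕋.T X.carrier) (x : X.carrier) :
    X.str t x * 𝕋.lift φ.1 t ≤ φ.1 x :=
  isGraphMor_graphV_iff.1 φ.2 t x

/-- The structure of `V^X` restricts along the unit to the pointwise structure. -/
theorem le_omega_hom_iff {v : V} {φ θ : PowerCarrier X.toTGraph} :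
    v ≤ (Omega X).hom φ θ ↔ ∀ x, v * φ.1 x ≤ θ.1 x := by
  have key : v ≤ (Omega X).hom φ θ ↔ ∀ q : tObj 𝕋.T (X.carrier × PowerCarrier X.toTGraph),
      tMap 𝕋.T Prod.snd q = tUnit 𝕋.T φ → ∀ x,
        v * X.str (tMap 𝕋.T Prod.fst q) x * 𝕋.lift (fun p => p.2.1 p.1) q ≤ θ.1 x := by
    rw [TGraph.hom]
    simp only [le_iInf_iff, le_qhom_iff]
    rfl
  rw [key]
  constructor
  · intro h x
    have h1 := h (tUnit 𝕋.T (x, φ)) (tMap_tUnit _ _ _) x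
    rw [tMap_tUnit, lift_tUnit] at h1
    refine le_trans (mul_le_mul_left ?_ _) h1
    calc v = v * 1 := (mul_one v).symm
      _ ≤ _ := mul_le_mul_right (X.refl x) v
  · intro h q hq x
    obtain ⟨q', rfl, -⟩ := 𝕋.exists_lift_snd (fun _ : PUnit.{u + 1} => φ) q
      (tUnit 𝕋.T PUnit.unit) (by rw [hq, tMap_tUnit])
    have h1 := str_mul_lift_le φ (tMap 𝕋.T Prod.fst q') x
    rw [lift_tMap] at h1
    rw [tMap_tMap, lift_tMap, mul_assoc]
    exact (mul_le_mul_right h1 v).trans (h x)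

theorem omega_hom_mul_le (φ θ : PowerCarrier X.toTGraph) (x : X.carrier) :
    (Omega X).hom φ θ * φ.1 x ≤ θ.1 x :=
  le_omega_hom_iff.1 le_rfl x

/-- Transitivity of `a`, as the graph morphism condition on `t ↦ a(t, -)`, transposed. -/
theorem str_mul_lift_str_snd_le (Q : tObj 𝕋.T (X.carrier × tObj 𝕋.T X.carrier)) (x : X.carrier) :
    X.str (tMap 𝕋.T Prod.fst Q) x * 𝕋.lift (fun y => X.str y.2 y.1) Q ≤
      X.str (tMult 𝕋.T (tMap 𝕋.T Prod.snd Q)) x := by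
  rw [mul_comm]
  exact (mul_le_mul_left (lift_le_ext X.str Prod.snd Prod.fst Q) _).trans
    (kleisli_le_iff.1 X.trans _ _ x)

theorem isVCat_omega : IsVCat (Omega X).hom := by
  refine ⟨fun φ => le_omega_hom_iff.2 fun x => (one_mul _).le, fun φ θ χ => ?_⟩
  refine le_omega_hom_iff.2 fun x => ?_
  calc (Omega X).hom φ θ * (Omega X).hom θ χ * φ.1 x
      = (Omega X).hom θ χ * ((Omega X).hom φ θ * φ.1 x) := by ac_rfl
    _ ≤ (Omega X).hom θ χ * θ.1 x := mul_le_mul_right (omega_hom_mul_le _ _ _) _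
    _ ≤ χ.1 x := omega_hom_mul_le _ _ _

theorem omega_ext_of_hom {φ θ : PowerCarrier X.toTGraph}
    (h : ∀ χ, (Omega X).hom φ χ = (Omega X).hom θ χ) : φ = θ := by
  have h1 : ∀ x, θ.1 x ≤ φ.1 x := fun x => by
    have := le_omega_hom_iff.1 ((isVCat_omega.1 φ).trans (h φ).le) x
    rwa [one_mul] at this
  have h2 : ∀ x, φ.1 x ≤ θ.1 x := fun x => by
    have := le_omega_hom_iff.1 ((isVCat_omega.1 θ).trans (h θ).ge) x
    rwa [one_mul] at this
  exact Subtype.ext (funext fun x => le_antisymm (h2 x) (h1 x))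

section

variable [Subsingleton (tObj 𝕋.T PUnit.{u + 1})]

/-- Transitivity of `a` over `e t`, which says that `a(t, -)` is a `T`-functor. -/
theorem str_mul_lift_str_le (t s : tObj 𝕋.T X.carrier) (x : X.carrier) :
    X.str s x * 𝕋.lift (X.str t) s ≤ X.str t x := by
  have h := kleisli_le_iff.1 X.trans (tUnit 𝕋.T t) s x
  rwa [ext_tUnit_left, tMult_tUnit, mul_comm] at h

variable (X) in
/-- The `T`-functor `a(t, -) : X → V` for `t ∈ T X`; at `t = e x` it represents the evaluation at
`x`. -/
def corepr (t : tObj 𝕋.T X.carrier) : PowerCarrier X.toTGraph :=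
  ⟨X.str t, isGraphMor_graphV_iff.2 fun s x => str_mul_lift_str_le t s x⟩

theorem omega_hom_corepr (x : X.carrier) (θ : PowerCarrier X.toTGraph) :
    (Omega X).hom (corepr X (tUnit 𝕋.T x)) θ = θ.1 x := by
  refine le_antisymm ?_ (le_omega_hom_iff.2 fun y => ?_)
  · calc _ = (Omega X).hom (corepr X (tUnit 𝕋.T x)) θ * 1 := (mul_one _).symm
      _ ≤ (Omega X).hom (corepr X (tUnit 𝕋.T x)) θ * (corepr X (tUnit 𝕋.T x)).1 x :=
        mul_le_mul_right (X.refl x) _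
      _ ≤ θ.1 x := omega_hom_mul_le _ _ _
  · have h := str_mul_lift_le θ (tUnit 𝕋.T x) y
    rwa [lift_tUnit, mul_comm] at h

/-- Weighted limits in `Ω X` are computed pointwise. -/
theorem isWLimit_omega_iff {I : Type u} {φ : I → V} {h : I → PowerCarrier X.toTGraph}
    {l : PowerCarrier X.toTGraph} :
    IsWLimit (Omega X).hom φ h l ↔ ∀ x, l.1 x = ⨅ i, qhom (φ i) ((h i).1 x) := by
  constructor
  · intro H x
    have h1 := H (corepr X (tUnit 𝕋.T x))
    simpa only [omega_hom_corepr] using h1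
  · intro H y
    refine eq_of_forall_le_iff fun v => ?_
    simp only [le_omega_hom_iff, H, le_iInf_iff, le_qhom_iff, mul_right_comm v (y.1 _)]
    exact forall_comm

theorem exists_isWLimit_omega {I : Type u} (φ : I → V) (h : I → PowerCarrier X.toTGraph) :
    ∃ l, IsWLimit (Omega X).hom φ h l := by
  refine ⟨⟨fun x => ⨅ i, qhom (φ i) ((h i).1 x), isGraphMor_graphV_iff.2 fun t x => ?_⟩,
    isWLimit_omega_iff.2 fun x => rfl⟩
  refine le_iInf fun i => le_qhom_iff.2 ?_
  have h1 : φ i * 𝕋.lift (fun x => ⨅ i, qhom (φ i) ((h i).1 x)) t ≤ 𝕋.lift (h i).1 t := by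
    rw [← lift_const_mul]
    refine lift_mono (fun y => ?_) t
    rw [mul_comm, ← le_qhom_iff]
    exact iInf_le _ i
  calc X.str t x * 𝕋.lift (fun x => ⨅ i, qhom (φ i) ((h i).1 x)) t * φ i
      = X.str t x * (φ i * 𝕋.lift (fun x => ⨅ i, qhom (φ i) ((h i).1 x)) t) := by ac_rfl
    _ ≤ X.str t x * 𝕋.lift (h i).1 t := mul_le_mul_right h1 _
    _ ≤ (h i).1 x := str_mul_lift_le _ _ _

/-- The pointwise tensor `v ⊗ φ` in `Ω X`. -/
def omegaTensor (v : V) (φ : PowerCarrier X.toTGraph) : PowerCarrier X.toTGraph :=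
  ⟨fun x => v * φ.1 x, isGraphMor_graphV_iff.2 fun t x => by
    rw [lift_const_mul, mul_left_comm]
    exact mul_le_mul_right (str_mul_lift_le _ _ _) v⟩

theorem isTensor_omegaTensor (v : V) (φ : PowerCarrier X.toTGraph) :
    IsTensor (Omega X).hom v φ (omegaTensor v φ) := by
  intro χ
  refine eq_of_forall_le_iff fun w => ?_
  simp only [le_omega_hom_iff, le_qhom_iff, mul_assoc, omegaTensor]

theorem IsTensor.eq_omegaTensor {v : V} {φ θ : PowerCarrier X.toTGraph}
    (h : IsTensor (Omega X).hom v φ θ) : θ = omegaTensor v φ :=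
  omega_ext_of_hom fun χ => by rw [h χ, isTensor_omegaTensor v φ χ]

/-- The graph morphism condition on the tensors of a `T`-weighted diagram in `Ω X`, transposed. -/
theorem IsTWeighted.str_mul_lift_le {I : 𝕋.T.Algebra} {r : I.A → I.A → V}
    {h : I.A → PowerCarrier X.toTGraph} {ψ : I.A → V} (H : IsTWeighted (Omega X) I r h ψ)
    (q : tObj 𝕋.T (X.carrier × I.A)) (x : X.carrier) :
    X.str (tMap 𝕋.T Prod.fst q) x * 𝕋.lift (fun p => ψ p.2 * (h p.2).1 p.1) q ≤
      ψ (I.a (tMap 𝕋.T Prod.snd q)) * (h (I.a (tMap 𝕋.T Prod.snd q))).1 x := by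
  obtain ⟨g, hg, hg'⟩ := H.tensor
  have h1 := isGraphMor_graphAlg_omega_iff.1 hg' q x
  rwa [funext fun i => (hg i).eq_omegaTensor] at h1

/-- `T`-colimits in `Ω X` are computed pointwise. -/
theorem IsTWeighted.colimit_apply {I : 𝕋.T.Algebra} {r : I.A → I.A → V}
    {h : I.A → PowerCarrier X.toTGraph} {ψ : I.A → V} (H : IsTWeighted (Omega X) I r h ψ)
    {l : PowerCarrier X.toTGraph} (hl : IsWColimit (Omega X).hom ψ h l) (x : X.carrier) :
    l.1 x = ⨆ i, ψ i * (h i).1 x := by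
  have hg : IsGraphMor X.toTGraph 𝕋.graphV (fun x => ⨆ i, ψ i * (h i).1 x) := by
    refine isGraphMor_graphV_iff.2 fun t x => ?_
    refine mul_lift_iSup_le (g := fun p : X.carrier × I.A => ψ p.2 * (h p.2).1 p.1) ?_
    rintro q rfl
    exact (H.str_mul_lift_le q x).trans (le_iSup (fun i => ψ i * (h i).1 x) _)
  have : l = ⟨fun x => ⨆ i, ψ i * (h i).1 x, hg⟩ := omega_ext_of_hom fun χ => by
    rw [hl χ]
    refine eq_of_forall_le_iff fun w => ?_
    simp only [le_omega_hom_iff, le_iInf_iff, le_qhom_iff, Quantale.mul_iSup_distrib, iSup_le_iff,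
      mul_assoc]
    exact forall_comm
  rw [this]

/-- The supremum of a `T`-generated presheaf `χ` on `Ω X` takes at `x` the value of `χ` at the
`T`-functor representing the evaluation at `x`; so it depends on `χ` through evaluations only. -/
theorem IsTGenerated.supremum_apply {χ : PowerCarrier X.toTGraph → V}
    (hχ : IsTGenerated (Omega X) χ) {s : PowerCarrier X.toTGraph}
    (hs : IsSupremum (Omega X).hom χ s) (x : X.carrier) :
    s.1 x = χ (corepr X (tUnit 𝕋.T x)) := by
  obtain ⟨I, r, h, ψ, H, hψ⟩ := hχ
  rw [H.colimit_apply (hs.isWColimit isVCat_omega hψ), hψ]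
  exact iSup_congr fun i => by rw [omega_hom_corepr, mul_comm]

variable (X) in
theorem isTFrame_omega : IsTFrame (Omega X) where
  vcat := isVCat_omega
  complete _ _ φ h _ _ _ := exists_isWLimit_omega φ h
  distrib I r φ h L _ _ _ hgen hL hLgen s l hs hl := by
    refine isWLimit_omega_iff.2 fun x => ?_
    rw [hLgen.supremum_apply hl, isWLimit_presheaf_apply isVCat_omega hL]
    exact iInf_congr fun i => by rw [(hgen i).supremum_apply (hs i)]

end

/-! ### Adjunctions with the one-point `T`-category -/

variable (X) in
/-- An adjunction `p ⊣ q` between `E` and `X`, spelled out for `T 1 = 1`: the left adjoint `E ⇸ X`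
is a function `p` on `T X` and the right adjoint `X ⇸ E` a function `q` on `X`. -/
structure IsPointAdj (p : tObj 𝕋.T X.carrier → V) (q : X.carrier → V) : Prop where
  lift_le : ∀ W, 𝕋.lift p W ≤ p (tMult 𝕋.T W)
  ext_mul_le : ∀ W t, 𝕋.ext X.str W t * p t ≤ p (tMult 𝕋.T W)
  isGraphMor : IsGraphMor X.toTGraph 𝕋.graphV q
  unit : 1 ≤ ⨆ t, 𝕋.lift q t * p t
  counit : ∀ t x, p t * q x ≤ X.str t x

/-- The composite of `θ : X → V`, viewed as a matrix `X ⇸ E`, with `p : E ⇸ X`. -/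
def pairing (p : tObj 𝕋.T X.carrier → V) (θ : X.carrier → V) : V :=
  ⨆ t, 𝕋.lift θ t * p t

theorem pairing_mono {p p' : tObj 𝕋.T X.carrier → V} (h : ∀ t, p t ≤ p' t) (θ : X.carrier → V) :
    pairing p θ ≤ pairing p' θ :=
  iSup_mono fun t => mul_le_mul_right (h t) _

variable [Subsingleton (tObj 𝕋.T PUnit.{u + 1})]

/-- An adjunction `φ ⊣ ψ : X ⇸ Y` of `T`-distributors composes with `y_* ⊣ y^*` to an adjunction
between `E` and `X`. -/
theorem IsAdj.isPointAdj {Y : TCat 𝕋} {φ : tObj 𝕋.T X.carrier → Y.carrier → V}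
    {ψ : tObj 𝕋.T Y.carrier → X.carrier → V} (H : IsAdj Y X φ ψ) (y : Y.carrier) :
    IsPointAdj X (fun t => φ t y) (ψ (tUnit 𝕋.T y)) where
  lift_le W := by
    have h := kleisli_le_iff.1 H.left_dist.1 W (tUnit 𝕋.T y) y
    refine le_trans ?_ h
    calc _ = 𝕋.lift (fun t => φ t y) W * 1 := (mul_one _).symm
      _ ≤ _ := mul_le_mul' (lift_le_ext_tUnit_right φ W y) (Y.refl y)
  ext_mul_le W t := kleisli_le_iff.1 H.left_dist.2 W t y
  isGraphMor := isGraphMor_graphV_iff.2 fun t x => by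
    have h := kleisli_le_iff.1 H.right_dist.1 (tUnit 𝕋.T (tUnit 𝕋.T y)) t x
    rwa [ext_tUnit_left, tMult_tUnit, mul_comm] at h
  unit := by
    rw [← kleisli_tUnit]
    exact (Y.refl y).trans (H.unit _ _)
  counit t x := by
    have h := kleisli_le_iff.1 H.counit (tUnit 𝕋.T t) (tUnit 𝕋.T y) x
    rwa [ext_tUnit_left, lift_tUnit, tMult_tUnit] at h

namespace IsPointAdj

variable {p : tObj 𝕋.T X.carrier → V} {q : X.carrier → V}

theorem isAdj (H : IsPointAdj X p q) :
    IsAdj 𝕋.unitCat X (fun t _ => p t) (fun _ x => q x) where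
  left_dist := ⟨kleisli_le_iff.2 fun W t _ =>
      (mul_one _).le.trans ((ext_le_lift_left p W t).trans (H.lift_le W)),
    kleisli_le_iff.2 fun W t _ => H.ext_mul_le W t⟩
  right_dist := by
    refine ⟨kleisli_le_iff.2 fun W t x => ?_, kleisli_le_iff.2 fun W t x => ?_⟩
    · refine (mul_le_mul_left (ext_le_lift_right q W t) _).trans ?_
      rw [mul_comm]
      exact isGraphMor_graphV_iff.1 H.isGraphMor t x
    · refine (mul_le_mul_left (ext_le_lift_right (fun _ => 1) W t) _).trans ?_
      rw [lift_const, one_mul]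
  unit s x := by
    rw [Subsingleton.elim s (tUnit 𝕋.T PUnit.unit), kleisli_tUnit]
    exact H.unit
  counit := kleisli_le_iff.2 fun W t x =>
    (mul_le_mul_left ((ext_le_lift_left p W t).trans (H.lift_le W)) _).trans (H.counit _ x)

end IsPointAdj

variable (X) in
theorem isPointAdj_pointStar (x : X.carrier) :
    IsPointAdj X (fun t => X.str t x) (X.str (tUnit 𝕋.T x)) where
  lift_le W := by
    refine le_trans ?_ (kleisli_le_iff.1 X.trans W (tUnit 𝕋.T x) x)
    calc _ = 𝕋.lift (fun t => X.str t x) W * 1 := (mul_one _).symm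
      _ ≤ _ := mul_le_mul' (lift_le_ext_tUnit_right X.str W x) (X.refl x)
  ext_mul_le W t := kleisli_le_iff.1 X.trans W t x
  isGraphMor := (corepr X (tUnit 𝕋.T x)).2
  unit := by
    refine le_trans ?_ (le_iSup _ (tUnit 𝕋.T x))
    rw [lift_tUnit]
    exact (one_mul (1 : V)).ge.trans (mul_le_mul' (X.refl x) (X.refl x))
  counit t y := by
    have h := str_mul_lift_str_le t (tUnit 𝕋.T x) y
    rwa [lift_tUnit, mul_comm] at h

/-! ### The point of `Ω X` given by a left adjoint `T`-distributor -/

theorem pairing_const_mul (p : tObj 𝕋.T X.carrier → V) (v : V) (θ : X.carrier → V) :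
    pairing p (fun x => v * θ x) = v * pairing p θ := by
  simp only [pairing, Quantale.mul_iSup_distrib, lift_const_mul, mul_assoc]

namespace IsPointAdj

variable {p : tObj 𝕋.T X.carrier → V} {q : X.carrier → V}

/-- Composition with the left adjoint `p` is the lifting `[q, -]` through its right adjoint. -/
theorem le_pairing_iff (H : IsPointAdj X p q) (θ : PowerCarrier X.toTGraph) {v : V} :
    v ≤ pairing p θ.1 ↔ ∀ x, v * q x ≤ θ.1 x := by
  constructor
  · intro h x
    refine (mul_le_mul_left h _).trans ?_
    rw [pairing, Quantale.iSup_mul_distrib]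
    refine iSup_le fun t => ?_
    rw [mul_assoc, mul_comm]
    exact (mul_le_mul_left (H.counit t x) _).trans (str_mul_lift_le θ t x)
  · intro h
    calc v = v * 1 := (mul_one v).symm
      _ ≤ v * ⨆ t, 𝕋.lift q t * p t := mul_le_mul_right H.unit v
      _ = ⨆ t, 𝕋.lift (fun x => v * q x) t * p t := by
        simp only [Quantale.mul_iSup_distrib, lift_const_mul, mul_assoc]
      _ ≤ pairing p θ.1 := iSup_mono fun t => mul_le_mul_left (lift_mono h t) _

theorem pairing_mul_le (H : IsPointAdj X p q) (θ : PowerCarrier X.toTGraph) (x : X.carrier) :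
    pairing p θ.1 * q x ≤ θ.1 x :=
  (H.le_pairing_iff θ).1 le_rfl x

theorem pairing_eq (H : IsPointAdj X p q) (θ : PowerCarrier X.toTGraph) :
    pairing p θ.1 = ⨅ x, qhom (q x) (θ.1 x) :=
  eq_of_forall_le_iff fun v => by simp only [H.le_pairing_iff, le_iInf_iff, le_qhom_iff]

/-- The left adjoint `p` can be recovered from the composites with it. -/
theorem pairing_corepr (H : IsPointAdj X p q) (t : tObj 𝕋.T X.carrier) :
    pairing p (corepr X t).1 = p t := by
  refine le_antisymm (iSup_le fun s => ?_) ((H.le_pairing_iff _).2 (H.counit t))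
  have h := H.ext_mul_le (tUnit 𝕋.T t) s
  rwa [ext_tUnit_left, tMult_tUnit] at h

/-- Composition with `p` is `T`-compatible. An element of `T (I × T X)` is sent to `T (X × I)` by
the strength of `T` followed by the multiplication; by `T 1 = 1` this keeps the component in
`T I`. -/
theorem lift_pairing_le (H : IsPointAdj X p q) {I : 𝕋.T.Algebra}
    {h : I.A → PowerCarrier X.toTGraph} (hh : IsGraphMor (𝕋.graphAlg I) (Omega X) h)
    (s : tObj 𝕋.T I.A) :
    𝕋.lift (fun i => pairing p (h i).1) s ≤ pairing p (h (I.a s)).1 := by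
  refine (H.le_pairing_iff _).2 fun x => ?_
  rw [mul_comm]
  refine mul_lift_iSup_le
    (g := fun y : I.A × tObj 𝕋.T X.carrier => 𝕋.lift (h y.1).1 y.2 * p y.2) fun w hw => ?_
  let strength : I.A × tObj 𝕋.T X.carrier → tObj 𝕋.T (X.carrier × I.A) :=
    fun y => tMap 𝕋.T (fun x => (x, y.1)) y.2
  let Q := tMult 𝕋.T (tMap 𝕋.T strength w)
  have h_fst : tMap 𝕋.T Prod.fst Q = tMult 𝕋.T (tMap 𝕋.T Prod.snd w) := by
    rw [← tMult_natural, tMap_tMap]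
    exact congrArg (fun f => tMult 𝕋.T (tMap 𝕋.T f w))
      (funext fun y => (tMap_tMap _ _ _ _).trans (tMap_id _ _))
  have h_snd : tMap 𝕋.T Prod.snd Q = s := by
    have : (fun y => tMap 𝕋.T Prod.snd (strength y)) = fun y => tUnit 𝕋.T y.1 :=
      funext fun y => (tMap_tMap _ _ _ _).trans (tMap_const _ _ _)
    rw [← tMult_natural, tMap_tMap, this, ← tMap_tMap 𝕋.T (fun i => tUnit 𝕋.T i) Prod.fst, hw,
      tMult_tMap_tUnit]
  have h_lift : 𝕋.lift (fun y : I.A × tObj 𝕋.T X.carrier => 𝕋.lift (h y.1).1 y.2) w =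
      𝕋.lift (fun y => (h y.2).1 y.1) Q := by
    rw [← lift_lift, lift_tMap]
    exact congrArg (fun f => 𝕋.lift f w) (funext fun y =>
      (lift_tMap (fun z : X.carrier × I.A => (h z.2).1 z.1) (fun x => (x, y.1)) y.2).symm)
  have h_p : 𝕋.lift (fun y : I.A × tObj 𝕋.T X.carrier => p y.2) w ≤ p (tMap 𝕋.T Prod.fst Q) := by
    rw [h_fst, ← lift_tMap p Prod.snd]
    exact H.lift_le _
  have h1 := isGraphMor_graphAlg_omega_iff.1 hh Q x
  rw [h_snd] at h1
  rw [lift_mul, h_lift]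
  calc q x * (𝕋.lift (fun y => (h y.2).1 y.1) Q * 𝕋.lift (fun y => p y.2) w)
      ≤ q x * (𝕋.lift (fun y => (h y.2).1 y.1) Q * p (tMap 𝕋.T Prod.fst Q)) :=
        mul_le_mul_right (mul_le_mul_right h_p _) _
    _ = p (tMap 𝕋.T Prod.fst Q) * q x * 𝕋.lift (fun y => (h y.2).1 y.1) Q := by ac_rfl
    _ ≤ X.str (tMap 𝕋.T Prod.fst Q) x * 𝕋.lift (fun y => (h y.2).1 y.1) Q :=
        mul_le_mul_left (H.counit _ x) _
    _ ≤ _ := h1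

/-- Composition with `p` preserves `T`-colimits: `ξ · T` of the pointwise colimit is a supremum over
`Q ∈ T (X × I)`, and the term at `Q` is bounded by the summand at the index in `I` over which `Q`
lies. -/
theorem pairing_tcolimit (H : IsPointAdj X p q) {I : 𝕋.T.Algebra} {r : I.A → I.A → V}
    {h : I.A → PowerCarrier X.toTGraph} {ψ : I.A → V} {l : PowerCarrier X.toTGraph}
    (hw : IsTWeighted (Omega X) I r h ψ) (hl : IsWColimit (Omega X).hom ψ h l) :
    pairing p l.1 = ⨆ i, ψ i * pairing p (h i).1 := by
  have hl' : l.1 = fun x => ⨆ i, ψ i * (h i).1 x := funext (hw.colimit_apply hl)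
  refine le_antisymm (iSup_le fun t => ?_) (iSup_le fun i => (H.le_pairing_iff l).2 fun x => ?_)
  · rw [hl', mul_comm]
    refine mul_lift_iSup_le (g := fun y : X.carrier × I.A => ψ y.2 * (h y.2).1 y.1) ?_
    rintro Q rfl
    refine le_trans ?_ (le_iSup _ (I.a (tMap 𝕋.T Prod.snd Q)))
    rw [← pairing_const_mul]
    refine (H.le_pairing_iff (omegaTensor _ _)).2 fun x => ?_
    rw [mul_right_comm]
    exact (mul_le_mul_left (H.counit _ x) _).trans (hw.str_mul_lift_le Q x)
  · rw [hl', mul_assoc]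
    exact (mul_le_mul_right (H.pairing_mul_le (h i) x) _).trans
      (le_iSup (fun i => ψ i * (h i).1 x) i)

theorem isTFrameHom (H : IsPointAdj X p q) :
    IsTFrameHom (Omega X) 𝕋.graphV (fun θ => pairing p θ.1) where
  vfun θ χ := by
    refine le_graphV_hom_iff.2 ((H.le_pairing_iff χ).2 fun x => ?_)
    rw [mul_assoc]
    exact (mul_le_mul_right (H.pairing_mul_le θ x) _).trans (omega_hom_mul_le θ χ x)
  compat _ _ hh := isGraphMor_graphAlg_graphV_iff.2 (H.lift_pairing_le hh)
  limits I r φ h l _ _ _ hl := by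
    rw [isWLimit_omega_iff] at hl
    refine isWLimit_graphV_iff.2 (eq_of_forall_le_iff fun v => ?_)
    simp only [H.le_pairing_iff, le_iInf_iff, le_qhom_iff, hl, mul_right_comm v (q _)]
    exact forall_comm
  tcolimits _ _ _ _ _ hw hl := isWColimit_graphV_iff.2 (H.pairing_tcolimit hw hl)

end IsPointAdj

/-! ### The left adjoint `T`-distributor given by a point of `Ω X` -/

variable (X) in
theorem isGraphMor_corepr :
    IsGraphMor (𝕋.graphAlg ((Monad.free 𝕋.T).obj X.carrier)) (Omega X) (corepr X) :=
  isGraphMor_graphAlg_omega_iff.2 str_mul_lift_str_snd_le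

/-- The `T`-functors `a(t, -)`, indexed by the free algebra `T X` with its discrete `V`-category
structure, form a `T`-weighted diagram with weight `ξ · T φ`. -/
theorem isTWeighted_corepr (φ : PowerCarrier X.toTGraph) :
    IsTWeighted (Omega X) ((Monad.free 𝕋.T).obj X.carrier) (fun s t => ⨆ (_ : s = t), (1 : V))
      (corepr X) (𝕋.lift φ.1) where
  vcat := by
    refine ⟨fun s => le_iSup_of_le rfl le_rfl, fun s t w => ?_⟩
    rw [← le_qhom_iff]
    refine iSup_le ?_
    rintro rfl
    rw [le_qhom_iff, one_mul]
  vfun s t := by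
    refine iSup_le ?_
    rintro rfl
    exact isVCat_omega.1 _
  weight s t := by
    rw [← le_qhom_iff]
    refine iSup_le ?_
    rintro rfl
    rw [le_qhom_iff, one_mul]
  tensor := by
    have key : ∀ (Q : tObj 𝕋.T (X.carrier × tObj 𝕋.T X.carrier)) (x : X.carrier),
        X.str (tMap 𝕋.T Prod.fst Q) x * 𝕋.lift (fun y => 𝕋.lift φ.1 y.2 * X.str y.2 y.1) Q ≤
          𝕋.lift φ.1 (tMult 𝕋.T (tMap 𝕋.T Prod.snd Q)) *
            X.str (tMult 𝕋.T (tMap 𝕋.T Prod.snd Q)) x := by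
      intro Q x
      rw [lift_mul (fun y : X.carrier × tObj 𝕋.T X.carrier => 𝕋.lift φ.1 y.2), ← lift_lift,
        lift_tMap, mul_left_comm]
      exact mul_le_mul_right (str_mul_lift_str_snd_le Q x) _
    exact ⟨fun t => omegaTensor (𝕋.lift φ.1 t) (corepr X t), fun t => isTensor_omegaTensor _ _,
      isGraphMor_graphAlg_omega_iff.2 key⟩

/-- Co-Yoneda: `φ` is the `T`-colimit of the `T`-functors `a(t, -)` weighted by `ξ · T φ`. -/
theorem isWColimit_corepr (φ : PowerCarrier X.toTGraph) :
    IsWColimit (Omega X).hom (𝕋.lift φ.1) (corepr X) φ := by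
  intro θ
  refine eq_of_forall_le_iff fun v => ?_
  simp only [le_omega_hom_iff, le_iInf_iff, le_qhom_iff]
  constructor
  · intro h t x
    rw [mul_assoc, mul_comm (𝕋.lift φ.1 t)]
    exact (mul_le_mul_right (str_mul_lift_le φ t x) v).trans (h x)
  · intro h x
    refine le_trans ?_ (h (tUnit 𝕋.T x) x)
    rw [lift_tUnit]
    calc v * φ.1 x = v * φ.1 x * 1 := (mul_one _).symm
      _ ≤ _ := mul_le_mul_right (X.refl x) _

/-- A limit-preserving `V`-functor `Ω X → V` is represented by the limit of the identity weighted by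
the functor itself. -/
theorem IsTFrameHom.exists_hom_eq {Φ : PowerCarrier X.toTGraph → V}
    (H : IsTFrameHom (Omega X) 𝕋.graphV Φ) :
    ∃ κ : PowerCarrier X.toTGraph, 1 ≤ Φ κ ∧ ∀ θ, Φ θ = (Omega X).hom κ θ := by
  obtain ⟨κ, hκ⟩ := exists_isWLimit_omega (X := X) Φ (fun θ => θ)
  have hΦ : ∀ θ χ, (Omega X).hom θ χ * Φ θ ≤ Φ χ := fun θ χ => le_graphV_hom_iff.1 (H.vfun θ χ)
  have h1 : 1 ≤ Φ κ := by
    have := H.limits _ (Omega X).hom Φ (fun θ => θ) κ isVCat_omega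
      (fun θ χ => by rw [mul_comm]; exact hΦ θ χ) (fun _ _ => le_rfl) hκ
    rw [isWLimit_graphV_iff.1 this]
    exact le_iInf fun θ => le_qhom_iff.2 (one_mul _).le
  refine ⟨κ, h1, fun θ => le_antisymm (le_omega_hom_iff.2 fun x => ?_) ?_⟩
  · rw [isWLimit_omega_iff.1 hκ x, mul_comm, ← le_qhom_iff]
    exact iInf_le _ θ
  · calc _ = (Omega X).hom κ θ * 1 := (mul_one _).symm
      _ ≤ (Omega X).hom κ θ * Φ κ := mul_le_mul_right h1 _
      _ ≤ Φ θ := hΦ κ θ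

/-- Every point `Φ` of `Ω X` is composition with a left adjoint `T`-distributor: since `Φ` must be
`[q, -]` for its right adjoint `q`, the left adjoint can only be `t ↦ Φ (a(t, -))`. -/
theorem IsTFrameHom.exists_isPointAdj {Φ : PowerCarrier X.toTGraph → V}
    (H : IsTFrameHom (Omega X) 𝕋.graphV Φ) :
    ∃ p q, IsPointAdj X p q ∧ ∀ θ, Φ θ = pairing p θ.1 := by
  obtain ⟨κ, h1, hκ⟩ := H.exists_hom_eq
  have counit : ∀ t x, Φ (corepr X t) * κ.1 x ≤ X.str t x := fun t x => by
    rw [hκ]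
    exact omega_hom_mul_le κ (corepr X t) x
  have A : IsPointAdj X (fun t => Φ (corepr X t)) κ.1 :=
    { lift_le := isGraphMor_graphAlg_graphV_iff.1 (H.compat _ _ (isGraphMor_corepr X))
      ext_mul_le := fun W t => by
        rw [hκ (corepr X (tMult 𝕋.T W))]
        refine le_omega_hom_iff.2 fun x => ?_
        rw [mul_assoc]
        exact (mul_le_mul_right (counit t x) _).trans (kleisli_le_iff.1 X.trans W t x)
      isGraphMor := κ.2
      unit := by
        have h := H.tcolimits _ _ _ _ _ (isTWeighted_corepr κ) (isWColimit_corepr κ)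
        rwa [isWColimit_graphV_iff.1 h] at h1
      counit := counit }
  exact ⟨_, _, A, fun θ => eq_of_forall_le_iff fun v => by
    rw [A.le_pairing_iff, hκ, le_omega_hom_iff]⟩

/-! ### The isomorphism and Cauchy completeness -/

theorem LeftAdj.exists_isPointAdj (ψ : LeftAdj X) :
    ∃ q, IsPointAdj X (fun t => ψ.1 t PUnit.unit) q := by
  obtain ⟨φ, h⟩ := ψ.2
  exact ⟨_, h.isPointAdj PUnit.unit⟩

theorem isLeftAdj_pointStar (x : X.carrier) : IsLeftAdj X (pointStar X x) :=
  ⟨_, (isPointAdj_pointStar X x).isAdj⟩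

theorem pairing_pointStar (x : X.carrier) (θ : PowerCarrier X.toTGraph) :
    pairing (fun t => X.str t x) θ.1 = θ.1 x := by
  rw [← omega_hom_corepr]
  exact eq_of_forall_le_iff fun v => by
    rw [(isPointAdj_pointStar X x).le_pairing_iff, le_omega_hom_iff]
    rfl

theorem isTFrameHom_evalAt (x : X.carrier) : IsTFrameHom (Omega X) 𝕋.graphV (evalAt X x) := by
  have h := (isPointAdj_pointStar X x).isTFrameHom
  rwa [funext (pairing_pointStar x)] at h

/-- A left adjoint `T`-distributor `E ⇸ X`, as the point of `Ω X` given by composition with it. -/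
def LeftAdj.toPoint (ψ : LeftAdj X) : Points X :=
  ⟨fun θ => pairing (fun t => ψ.1 t PUnit.unit) θ.1, ψ.exists_isPointAdj.choose_spec.isTFrameHom⟩

theorem LeftAdj.toPoint_le_toPoint_iff {ψ ψ' : LeftAdj X} :
    ψ.toPoint ≤ ψ'.toPoint ↔ ψ ≤ ψ' := by
  constructor
  · intro h t x
    obtain ⟨q, hq⟩ := ψ.exists_isPointAdj
    obtain ⟨q', hq'⟩ := ψ'.exists_isPointAdj
    have h1 : pairing _ _ ≤ pairing _ _ := h (corepr X t)
    rwa [hq.pairing_corepr, hq'.pairing_corepr] at h1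
  · intro h θ
    exact pairing_mono (fun t => h t PUnit.unit) θ.1

theorem LeftAdj.toPoint_surjective :
    Function.Surjective (LeftAdj.toPoint : LeftAdj X → Points X) := by
  rintro ⟨Φ, hΦ⟩
  obtain ⟨p, q, h, e⟩ := hΦ.exists_isPointAdj
  exact ⟨⟨fun t _ => p t, _, h.isAdj⟩, Subtype.ext (funext fun θ => (e θ).symm)⟩

variable (X) in
/-- The left adjoint `T`-distributors `E ⇸ X` are the points of `Ω X`. -/
noncomputable def leftAdjOrderIsoPoints : LeftAdj X ≃o Points X :=
  RelIso.ofSurjective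
    (OrderEmbedding.ofMapLEIff LeftAdj.toPoint fun _ _ => LeftAdj.toPoint_le_toPoint_iff)
    LeftAdj.toPoint_surjective

theorem leftAdjOrderIsoPoints_pointStar (x : X.carrier) :
    leftAdjOrderIsoPoints X ⟨pointStar X x, isLeftAdj_pointStar x⟩ =
      ⟨evalAt X x, isTFrameHom_evalAt x⟩ :=
  Subtype.ext (funext (pairing_pointStar x))

/-- An adjunction `φ ⊣ ψ` whose left adjoint is pointwise of the form `x_*` is induced by a
`T`-functor. -/
theorem IsAdj.eq_star {Y : TCat 𝕋} {φ : tObj 𝕋.T X.carrier → Y.carrier → V}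
    {ψ : tObj 𝕋.T Y.carrier → X.carrier → V} (H : IsAdj Y X φ ψ) {f : Y.carrier → X.carrier}
    (hf : φ = lowerStar Y X f) :
    IsGraphMor Y.toTGraph X.toTGraph f ∧ ψ = upperStar Y X f := by
  have h_unit : ∀ y, 1 ≤ ψ (tUnit 𝕋.T y) (f y) := by
    intro y
    refine (H.isPointAdj y).unit.trans (iSup_le fun t => ?_)
    rw [hf, mul_comm]
    exact isGraphMor_graphV_iff.1 (H.isPointAdj y).isGraphMor t (f y)
  have h_dist := kleisli_le_iff.1 H.right_dist.1
  have hψ : ψ = upperStar Y X f := by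
    funext s x
    -- In place of associativity of Kleisli composition: the counit at `T e (T f s)`, which lies
    -- over `T f s`, gives `≤`, and the distributor law of `ψ` at `T e s`, over `s`, gives `≥`.
    have hm : tMult 𝕋.T (tMap 𝕋.T (fun y => tUnit 𝕋.T (f y)) s) = tMap 𝕋.T f s := by
      rw [← tMap_tMap 𝕋.T (fun x => tUnit 𝕋.T x) f, tMult_tMap_tUnit]
    have h1 : 1 ≤ 𝕋.ext φ (tMap 𝕋.T (fun y => tUnit 𝕋.T (f y)) s) s := by
      have h := lift_le_ext φ (fun y => tUnit 𝕋.T (f y)) (fun y => y) s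
      rw [tMap_id] at h
      refine le_trans ?_ h
      rw [hf, ← lift_const (𝕋 := 𝕋) 1 s]
      exact lift_mono (fun y => X.refl (f y)) s
    have h2 : 1 ≤ 𝕋.ext ψ (tMap 𝕋.T (fun y => tUnit 𝕋.T y) s) (tMap 𝕋.T f s) := by
      refine le_trans ?_ (lift_le_ext ψ (fun y => tUnit 𝕋.T y) f s)
      rw [← lift_const (𝕋 := 𝕋) 1 s]
      exact lift_mono h_unit s
    refine le_antisymm ?_ ?_
    · have h := kleisli_le_iff.1 H.counit (tMap 𝕋.T (fun y => tUnit 𝕋.T (f y)) s) s x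
      rw [hm] at h
      calc ψ s x = 1 * ψ s x := (one_mul _).symm
        _ ≤ _ := mul_le_mul_left h1 _
        _ ≤ _ := h
    · have h := h_dist (tMap 𝕋.T (fun y => tUnit 𝕋.T y) s) (tMap 𝕋.T f s) x
      rw [tMult_tMap_tUnit] at h
      calc X.str (tMap 𝕋.T f s) x = 1 * X.str (tMap 𝕋.T f s) x := (one_mul _).symm
        _ ≤ _ := mul_le_mul_left h2 _
        _ ≤ _ := h
  refine ⟨fun s y => (H.unit s y).trans ?_, hψ⟩
  have h : ψ s (f y) = X.str (tMap 𝕋.T f s) (f y) := by rw [hψ]; rfl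
  rw [← h]
  refine iSup_le fun W => iSup_le fun hW => iSup_le fun t => ?_
  rw [← hW, hf]
  exact h_dist W t (f y)

variable (X) in
theorem isCauchyComplete_iff :
    IsCauchyComplete X ↔ ∀ ψ : LeftAdj X, ∃ x, ψ.1 = pointStar X x := by
  constructor
  · rintro h ⟨ψ, φ, hψ⟩
    obtain ⟨f, -, hf, -⟩ := h _ _ _ hψ
    exact ⟨f PUnit.unit, hf⟩
  · intro h Y φ ψ H
    choose f hf using fun y => h ⟨fun t _ => φ t y, _, (H.isPointAdj y).isAdj⟩
    have hφ : φ = lowerStar Y X f := by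
      funext t y
      exact congrFun (congrFun (hf y) t) PUnit.unit
    exact ⟨f, (H.eq_star hφ).1, hφ, (H.eq_star hφ).2⟩

end StrictTheory

theorem theorem2 {V : Type u} [CompleteLattice V] [CommMonoid V] [IsQuantale V]
    (𝕋 : StrictTheory V) (hT : Nonempty (Unique (tObj 𝕋.T PUnit.{u + 1})))
    (X : StrictTheory.TCat 𝕋) :
    StrictTheory.IsTFrame (StrictTheory.Omega X) ∧ StrictTheory.IsTFrame 𝕋.graphV ∧
    ∃ (hstar : ∀ x, StrictTheory.IsLeftAdj X (StrictTheory.pointStar X x))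
      (hev : ∀ x, StrictTheory.IsTFrameHom (StrictTheory.Omega X) 𝕋.graphV
        (StrictTheory.evalAt X x))
      (F : StrictTheory.LeftAdj X ≃o StrictTheory.Points X),
      (∀ x, F ⟨StrictTheory.pointStar X x, hstar x⟩ = ⟨StrictTheory.evalAt X x, hev x⟩) ∧
      (∀ (ψ : StrictTheory.LeftAdj X)
        (φ : tObj 𝕋.T 𝕋.unitCat.carrier → X.carrier → V),
        StrictTheory.IsAdj 𝕋.unitCat X ψ.1 φ →
        ∀ θ, (F ψ).1 θ = ⨅ x, qhom (φ (tUnit 𝕋.T PUnit.unit) x) (θ.1 x)) ∧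
      (StrictTheory.IsCauchyComplete X ↔
        Function.Surjective
          (fun x => (⟨StrictTheory.evalAt X x, hev x⟩ : StrictTheory.Points X))) := by
  obtain ⟨hU⟩ := hT
  have : Subsingleton (tObj 𝕋.T PUnit.{u + 1}) := hU.instSubsingleton
  refine ⟨StrictTheory.isTFrame_omega X, StrictTheory.isTFrame_graphV 𝕋,
    StrictTheory.isLeftAdj_pointStar, StrictTheory.isTFrameHom_evalAt,
    StrictTheory.leftAdjOrderIsoPoints X, StrictTheory.leftAdjOrderIsoPoints_pointStar,
    fun ψ φ h θ => (h.isPointAdj PUnit.unit).pairing_eq θ, ?_⟩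
  rw [StrictTheory.isCauchyComplete_iff]
  constructor
  · intro h Φ
    obtain ⟨ψ, rfl⟩ := (StrictTheory.leftAdjOrderIsoPoints X).surjective Φ
    obtain ⟨x, hx⟩ := h ψ
    refine ⟨x, ?_⟩
    exact (StrictTheory.leftAdjOrderIsoPoints_pointStar x).symm.trans
      (congrArg _ (Subtype.ext hx.symm))
  · intro h ψ
    obtain ⟨x, hx⟩ := h (StrictTheory.leftAdjOrderIsoPoints X ψ)
    refine ⟨x, ?_⟩
    have hx' := (StrictTheory.leftAdjOrderIsoPoints_pointStar x).trans hx
    exact (congrArg Subtype.val ((StrictTheory.leftAdjOrderIsoPoints X).injective hx')).symm
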